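/- Let $G$ be a (finite-dimensional, real, Hausdorff, second countable) Lie group with neutral element $e$ and Lie algebra $\mathfrak g$, let $Y_1,\dots,Y_d$ be a basis of $\mathfrak g$, regarded as left-invariant vector fields on $G$, and let $C_c^\infty(G)$ be the space of smooth compactly supported functions $G\to\mathbb R$. We say that $x_1,\dots,x_d\in C_c^\infty(G)$ are canonical co-ordinates in an open neighbourhood $U$ of $e$ if $x_i(e)=0$ for all $i$ and $g=\exp\bigl(\sum_{i=1}^d x_i(g)Y_i\bigr)$ for all $g\in U$; an open neighbourhood $U$ of $e$ in which such functions exist is called a canonical co-ordinate neighbourhood. A Lévy measure on $G$ is a Borel measure $\mu$ on $G\setminus\{e\}$ such that $$\int_{U\setminus\{e\}}\sum_{i=1}^d x_i(g)^2\,\mu(dg)<\infty\quad\text{and}\quad \mu(U^c)<\infty$$ for every canonical co-ordinate neighbourhood $U$ of $e$ and all canonical co-ordinates $x_1,\dots,x_d\in C_c^\infty(G)$ in $U$. Fix $x_1,\dots,x_d\in C_c^\infty(G)$ that are canonical co-ordinates in some neighbourhood of $e$. Let $T:C_c^\infty(G)\to\mathbb R$ be a linear functional satisfying the positive maximum principle: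 whenever $f\in C_c^\infty(G)$ and $f(e)=\sup_{\tau\in G}f(\tau)\ge 0$, then $Tf\le 0$. Then there exist $c\ge 0$, $b=(b_1,\dots,b_d)\in\mathbb R^d$, a non-negative definite symmetric real $d\times d$ matrix $a=(a_{ij})$, and a Lévy measure $\mu$ on $G$ such that for all $f\in C_c^\infty(G)$ the function $g\mapsto f(g)-f(e)-\sum_{i=1}^d x_i(g)\,Y_if(e)$ is $\mu$-integrable on $G\setminus\{e\}$ and $$Tf=\sum_{i,j=1}^d a_{ij}\,Y_iY_jf(e)+\sum_{i=1}^d b_i\,Y_if(e)-c\,f(e)+\int_{G\setminus\{e\}}\Bigl(f(g)-f(e)-\sum_{i=1}^d x_i(g)\,Y_if(e)\Bigr)\mu(dg).$$ -/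

import Mathlib

open Set MeasureTheory
open scoped Manifold ContDiff Topology

noncomputable section

namespace LieCourrege

variable {E : Type*} [NormedAddCommGroup E] [NormedSpace ℝ E]
  {G : Type*} [TopologicalSpace G] [ChartedSpace E G] [Group G]

/-- The left-invariant field of `X` is mapped to itself by left translations. -/
theorem mulInvariantVectorField_mul [LieGroup 𝓘(ℝ, E) ∞ G]
    (X : GroupLieAlgebra 𝓘(ℝ, E) G) (x g : G) :
    mulInvariantVectorField X (x * g) =
      mfderiv 𝓘(ℝ, E) 𝓘(ℝ, E) (x * ·) g (mulInvariantVectorField X g) := by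
  have hd : ∀ y z : G, MDifferentiableAt 𝓘(ℝ, E) 𝓘(ℝ, E) (y * ·) z := fun y z =>
    (contMDiff_mul_left (I := 𝓘(ℝ, E)) (n := ∞)).contMDiffAt.mdifferentiableAt (by simp)
  have D : (fun z : G => x * g * z) = (x * ·) ∘ (g * ·) := by
    ext z; simp [mul_assoc]
  have h1 : mfderiv 𝓘(ℝ, E) 𝓘(ℝ, E) (fun z : G => x * g * z) 1 =
      (mfderiv 𝓘(ℝ, E) 𝓘(ℝ, E) (x * ·) (g * 1)).comp
        (mfderiv 𝓘(ℝ, E) 𝓘(ℝ, E) (g * ·) (1 : G)) := by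
    rw [D]
    exact mfderiv_comp (1 : G) (hd x (g * 1)) (hd g 1)
  have key : ∀ (w : G) (e : E), g * 1 = w →
      (mfderiv 𝓘(ℝ, E) 𝓘(ℝ, E) (x * ·) (g * 1) : E → E) e =
        (mfderiv 𝓘(ℝ, E) 𝓘(ℝ, E) (x * ·) w : E → E) e := by
    rintro w e rfl; rfl
  exact (congrArg (fun L : E →L[ℝ] E => L X) h1).trans (key g _ (mul_one g))

/-- Left-invariant vector fields on a Lie group are complete. -/
theorem exists_integralCurve [FiniteDimensional ℝ E] [T2Space G] [LieGroup 𝓘(ℝ, E) ∞ G]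
    (X : GroupLieAlgebra 𝓘(ℝ, E) G) :
    ∃ γ : ℝ → G, γ 0 = 1 ∧
      IsMIntegralCurve (I := 𝓘(ℝ, E)) γ (mulInvariantVectorField X) := by
  have : CompleteSpace E := FiniteDimensional.complete ℝ E
  have : LieGroup 𝓘(ℝ, E) (minSmoothness ℝ 3) G := by
    rw [minSmoothness_of_isRCLikeNormedField]
    infer_instance
  have : IsManifold 𝓘(ℝ, E) ∞ G := inferInstance
  have : IsManifold 𝓘(ℝ, E) 1 G := IsManifold.of_le (n := ∞) (by exact_mod_cast le_top)
  have hv : ContMDiff 𝓘(ℝ, E) (𝓘(ℝ, E).tangent) 1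
      (fun g : G => (⟨g, mulInvariantVectorField X g⟩ : TangentBundle 𝓘(ℝ, E) G)) :=
    (contMDiff_mulInvariantVectorField X).of_le
      (le_trans (by norm_num) le_minSmoothness)
  obtain ⟨γ, h0, hγ⟩ := exists_isMIntegralCurveAt_of_contMDiffAt_boundaryless
    (t₀ := 0) (x₀ := (1 : G)) (v := mulInvariantVectorField X) hv.contMDiffAt
  obtain ⟨ε, hε, hγ⟩ := isMIntegralCurveAt_iff'.1 hγ
  refine exists_isMIntegralCurve_of_isMIntegralCurveOn hv hε (fun x => ?_) 1
  refine ⟨fun t => x * γ t, by simp [h0], fun t ht => ?_⟩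
  have ht' : t ∈ Metric.ball (0 : ℝ) ε := by simpa [Real.ball_eq_Ioo] using ht
  have hx : HasMFDerivAt 𝓘(ℝ, E) 𝓘(ℝ, E) (x * ·) (γ t)
      (mfderiv 𝓘(ℝ, E) 𝓘(ℝ, E) (x * ·) (γ t)) :=
    ((contMDiff_mul_left (I := 𝓘(ℝ, E)) (n := ∞)).contMDiffAt.mdifferentiableAt
      (by simp)).hasMFDerivAt
  have h1 := hγ t ht'
  rw [Real.ball_eq_Ioo, zero_sub, zero_add] at h1
  have h2 := hx.comp_hasMFDerivWithinAt t h1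
  have h3 : ((1 : ℝ →L[ℝ] ℝ).smulRight (mulInvariantVectorField X (x * γ t) : E)) =
      (mfderiv 𝓘(ℝ, E) 𝓘(ℝ, E) (x * ·) (γ t) : E →L[ℝ] E).comp
        ((1 : ℝ →L[ℝ] ℝ).smulRight (mulInvariantVectorField X (γ t) : E)) := by
    rw [mulInvariantVectorField_mul]
    ext
    simp
  exact h2.congr_mfderiv h3.symm

/-- The exponential map `𝔤 → G`: the value at time `1` of the integral curve starting at `1` of the
left-invariant vector field of `X`. -/
def lieExp [FiniteDimensional ℝ E] [T2Space G] [LieGroup 𝓘(ℝ, E) ∞ G]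
    (X : GroupLieAlgebra 𝓘(ℝ, E) G) : G :=
  (exists_integralCurve X).choose 1

/-- The exponential map does not depend on the choice of the integral curve. -/
theorem lieExp_eq [FiniteDimensional ℝ E] [T2Space G] [LieGroup 𝓘(ℝ, E) ∞ G]
    (X : GroupLieAlgebra 𝓘(ℝ, E) G) {γ : ℝ → G} (h0 : γ 0 = 1)
    (hγ : IsMIntegralCurve (I := 𝓘(ℝ, E)) γ (mulInvariantVectorField X)) :
    lieExp X = γ 1 := by
  have : CompleteSpace E := FiniteDimensional.complete ℝ E
  have : LieGroup 𝓘(ℝ, E) (minSmoothness ℝ 3) G := by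
    rw [minSmoothness_of_isRCLikeNormedField]
    infer_instance
  have : IsManifold 𝓘(ℝ, E) 1 G := IsManifold.of_le (n := ∞) (by exact_mod_cast le_top)
  have hv : ContMDiff 𝓘(ℝ, E) (𝓘(ℝ, E).tangent) 1
      (fun g : G => (⟨g, mulInvariantVectorField X g⟩ : TangentBundle 𝓘(ℝ, E) G)) :=
    (contMDiff_mulInvariantVectorField X).of_le
      (le_trans (by norm_num) le_minSmoothness)
  have hc := (exists_integralCurve X).choose_spec
  exact congrFun (isMIntegralCurve_Ioo_eq_of_contMDiff_boundaryless (t₀ := 0) hv hc.2 hγ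
    (hc.1.trans h0.symm)) 1

variable (E G) in
/-- The space `C_c^∞(G)` of smooth real-valued functions with compact support. -/
def SmoothCc : Submodule ℝ (G → ℝ) where
  carrier := {f | ContMDiff 𝓘(ℝ, E) 𝓘(ℝ, ℝ) ∞ f ∧ HasCompactSupport f}
  zero_mem' := ⟨contMDiff_const, HasCompactSupport.zero⟩
  add_mem' := fun hf hg => ⟨hf.1.add hg.1, hf.2.add hg.2⟩
  smul_mem' := by
    intro c f hf
    have hc : ContMDiff 𝓘(ℝ, E) 𝓘(ℝ, ℝ) ∞ (fun _ : G => c) := contMDiff_const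
    exact ⟨hc.smul hf.1, hf.2.smul_left (f := fun _ => c)⟩

/-- The action `X f` of the left-invariant vector field of `X` on a real function `f`. -/
def lieDeriv (X : GroupLieAlgebra 𝓘(ℝ, E) G) (f : G → ℝ) : G → ℝ :=
  fun g => mfderiv 𝓘(ℝ, E) 𝓘(ℝ, ℝ) f g (mulInvariantVectorField X g)

/-- The positive maximum principle: if `f(e) = sup f ≥ 0` then `T f ≤ 0`. -/
def SatisfiesPMP (T : SmoothCc E G →ₗ[ℝ] ℝ) : Prop :=
  ∀ f : SmoothCc E G, IsLUB (range (f : G → ℝ)) ((f : G → ℝ) 1) → 0 ≤ (f : G → ℝ) 1 → T f ≤ 0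

/-- `U` is a canonical coordinate neighbourhood of the identity with respect to the basis `Y` of the
Lie algebra, and the functions `x i ∈ C_c^∞(G)` are canonical coordinates in `U`. Since the `x i` are
smooth and `g ↦ exp (∑ i, x i g • Y i)` is the identity on `U`, the map `(x 1, …, x d)` is
automatically a diffeomorphism of `U` onto an open neighbourhood of `0` in `ℝ^d`, with inverse
given by the exponential map. -/
structure IsCanonicalCoord [FiniteDimensional ℝ E] [T2Space G] [LieGroup 𝓘(ℝ, E) ∞ G] {d : ℕ}
    (Y : Module.Basis (Fin d) ℝ (GroupLieAlgebra 𝓘(ℝ, E) G)) (U : Set G)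
    (x : Fin d → SmoothCc E G) : Prop where
  isOpen : IsOpen U
  one_mem : (1 : G) ∈ U
  map_one : ∀ i, (x i : G → ℝ) 1 = 0
  exp_eq : ∀ g ∈ U, lieExp (∑ i, (x i : G → ℝ) g • Y i) = g

/-- Lévy measures on `G`. Borel measures on `G \ {e}` are identified with the Borel measures on `G`
which do not charge `{e}`. -/
structure IsLevyMeasure [FiniteDimensional ℝ E] [T2Space G] [LieGroup 𝓘(ℝ, E) ∞ G]
    [MeasurableSpace G] {d : ℕ} (Y : Module.Basis (Fin d) ℝ (GroupLieAlgebra 𝓘(ℝ, E) G))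
    (μ : Measure G) : Prop where
  singleton_one : μ {1} = 0
  lintegral_lt_top : ∀ (U : Set G) (x : Fin d → SmoothCc E G), IsCanonicalCoord Y U x →
    ∫⁻ g in U \ {1}, ENNReal.ofReal (∑ i, (x i : G → ℝ) g ^ 2) ∂μ < ⊤
  compl_lt_top : ∀ (U : Set G) (x : Fin d → SmoothCc E G), IsCanonicalCoord Y U x → μ Uᶜ < ⊤

end LieCourrege

end

open LieCourrege

namespace LieCourrege

/-! ### Taylor's formula along one-parameter subgroups -/

section Taylor

/-! The principle makes `T` positive on nonnegative functions vanishing at `1`. Fix a smooth weight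
`q` vanishing only at `1` and dominating `∑ x_i²`. Then `h ↦ T (h q)` is positive; by M. Riesz
extension and Riesz–Markov it is integration against a measure `ν`, and `μ = q⁻¹ ν` off `1`
represents `T` on every `f` that is `o(q)` at `1`
(`SatisfiesPMP.exists_measure_integral_eq_of_tendsto`).

By `IsCanonicalCoord.tendsto_taylor_remainder_div`, the second-order Taylor remainder of any `f` is
such a function once the constant `f(1)` is replaced by `f(1) χ`, with `χ` a cutoff. Expanding `T`
of this remainder gives the formula. The coefficients `a` and `c` measure how far `μ` falls short of
`T` on `x_i x_j` and on `χ - 1`. Their signs come from `lintegral_ofReal_le_of_forall_map_le`: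
truncations vanishing near `1` are integrated exactly, so in the limit only an inequality survives.
The same inequalities show that `μ` is a Lévy measure. -/

theorem norm_taylor_two_remainder_le {F F₁ F₂ F₃ : ℝ → ℝ} {C : ℝ}
    (h₁ : ∀ t, HasDerivAt F (F₁ t) t) (h₂ : ∀ t, HasDerivAt F₁ (F₂ t) t)
    (h₃ : ∀ t, HasDerivAt F₂ (F₃ t) t) (hC : ∀ t, |F₃ t| ≤ C) :
    |F 1 - F 0 - F₁ 0 - 1 / 2 * F₂ 0| ≤ C := by
  have hC0 : 0 ≤ C := (abs_nonneg _).trans (hC 0)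
  -- Three mean value estimates on `[0, 1]` replace the integral remainder; they give `C` instead of
  -- `C / 6`, which suffices.
  have mvt : ∀ {H H' : ℝ → ℝ}, (∀ t, HasDerivAt H (H' t) t) → H 0 = 0 →
      (∀ t ∈ Icc (0 : ℝ) 1, |H' t| ≤ C) → ∀ t ∈ Icc (0 : ℝ) 1, |H t| ≤ C := by
    intro H H' hd h0 hb t ht
    have := (convex_Icc (0 : ℝ) 1).norm_image_sub_le_of_norm_hasDerivWithin_le
      (fun s _ => (hd s).hasDerivWithinAt) (fun s hs => by simpa using hb s hs)
      (left_mem_Icc.2 zero_le_one) ht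
    rw [h0, sub_zero, sub_zero, Real.norm_eq_abs, Real.norm_eq_abs, abs_of_nonneg ht.1] at this
    exact this.trans (mul_le_of_le_one_right hC0 ht.2)
  have b₂ := mvt (H := fun t => F₂ t - F₂ 0) (fun t => (h₃ t).sub_const _) (by simp)
    fun t _ => hC t
  have b₁ := mvt (H := fun t => F₁ t - F₁ 0 - t * F₂ 0)
    (fun t => (((h₂ t).sub_const (F₁ 0)).sub
      ((hasDerivAt_id t).mul_const (F₂ 0))).congr_deriv (by simp))
    (by simp) b₂
  have b₀ := mvt (H := fun t => F t - F 0 - t * F₁ 0 - 1 / 2 * t ^ 2 * F₂ 0)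
    (H' := fun t => F₁ t - F₁ 0 - t * F₂ 0)
    (fun t => by
      have e := (((h₁ t).sub_const (F 0)).sub ((hasDerivAt_id t).mul_const (F₁ 0))).sub
        (((hasDerivAt_pow 2 t).const_mul (1 / 2)).mul_const (F₂ 0))
      refine e.congr_deriv ?_
      simp) (by simp) b₁ 1 (right_mem_Icc.2 zero_le_one)
  simpa using b₀

variable {E : Type*} [NormedAddCommGroup E] [NormedSpace ℝ E]
  {G : Type*} [TopologicalSpace G] [ChartedSpace E G] [Group G]

theorem lieDeriv_sum_smul_left {ι : Type*} (s : Finset ι) (v : ι → ℝ)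
    (Y : ι → GroupLieAlgebra 𝓘(ℝ, E) G) (f : G → ℝ) (g : G) :
    lieDeriv (∑ i ∈ s, v i • Y i) f g = ∑ i ∈ s, v i * lieDeriv (Y i) f g := by
  have h : ∀ X : GroupLieAlgebra 𝓘(ℝ, E) G, lieDeriv X f g =
      ((mfderiv 𝓘(ℝ, E) 𝓘(ℝ, ℝ) f g : E →L[ℝ] ℝ).comp
        (mfderiv 𝓘(ℝ, E) 𝓘(ℝ, E) (g * ·) (1 : G) : E →L[ℝ] E)) X := fun _ => rfl
  simp only [h]
  rw [map_sum]
  simp only [map_smul]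
  rfl

theorem lieDeriv_sum_mul {ι : Type} (s : Finset ι) (v : ι → ℝ)
    (X : GroupLieAlgebra 𝓘(ℝ, E) G) {f : ι → G → ℝ} {g : G}
    (hf : ∀ i ∈ s, MDifferentiableAt 𝓘(ℝ, E) 𝓘(ℝ, ℝ) (f i) g) :
    lieDeriv X (fun g => ∑ i ∈ s, v i * f i g) g = ∑ i ∈ s, v i * lieDeriv X (f i) g := by
  have h : HasMFDerivAt 𝓘(ℝ, E) 𝓘(ℝ, ℝ) (∑ i ∈ s, v i • f i) g
      (∑ i ∈ s, v i • mfderiv 𝓘(ℝ, E) 𝓘(ℝ, ℝ) (f i) g) :=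
    HasMFDerivAt.sum fun i hi => (hf i hi).hasMFDerivAt.const_smul (v i)
  have e : (fun g => ∑ i ∈ s, v i * f i g) = ∑ i ∈ s, v i • f i := by
    ext; simp
  rw [e, lieDeriv, h.mfderiv]
  exact _root_.sum_apply _ _ _

theorem hasCompactSupport_lieDeriv (X : GroupLieAlgebra 𝓘(ℝ, E) G) {f : G → ℝ}
    (hf : HasCompactSupport f) : HasCompactSupport (lieDeriv X f) := by
  refine hf.mono' fun g hg => ?_
  by_contra h
  refine hg ?_
  have : f =ᶠ[𝓝 g] fun _ => 0 := notMem_tsupport_iff_eventuallyEq.1 h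
  rw [lieDeriv, this.mfderiv_eq, mfderiv_const]
  rfl

theorem hasDerivAt_comp_integralCurve {X : GroupLieAlgebra 𝓘(ℝ, E) G} {γ : ℝ → G}
    (hγ : IsMIntegralCurve (I := 𝓘(ℝ, E)) γ (mulInvariantVectorField X)) {f : G → ℝ}
    (hf : ContMDiff 𝓘(ℝ, E) 𝓘(ℝ, ℝ) 1 f) (t : ℝ) :
    HasDerivAt (fun t => f (γ t)) (lieDeriv X f (γ t)) t := by
  have h := ((hf.contMDiffAt (x := γ t)).mdifferentiableAt one_ne_zero).hasMFDerivAt.comp t (hγ t)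
  have h' : HasFDerivAt (fun t => f (γ t)) ((mfderiv 𝓘(ℝ, E) 𝓘(ℝ, ℝ) f (γ t) : E →L[ℝ] ℝ).comp
      ((1 : ℝ →L[ℝ] ℝ).smulRight (mulInvariantVectorField X (γ t) : E))) t :=
    hasMFDerivAt_iff_hasFDerivAt.1 h
  refine hasDerivAt_iff_hasFDerivAt.2 (h'.congr_fderiv ?_)
  ext
  change mfderiv 𝓘(ℝ, E) 𝓘(ℝ, ℝ) f (γ t) ((1 : ℝ) • mulInvariantVectorField X (γ t)) =
    (1 : ℝ) • lieDeriv X f (γ t)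
  rw [one_smul, one_smul]
  rfl

variable [LieGroup 𝓘(ℝ, E) ∞ G]

/-- `X f` is the fibre component of the tangent map of `f` composed with the invariant field. The
field enters as a `C²` section, whence `n ≤ 2`; this allows the three derivatives needed below. -/
theorem contMDiff_lieDeriv [CompleteSpace E] (X : GroupLieAlgebra 𝓘(ℝ, E) G) {f : G → ℝ} {n : ℕ∞ω}
    (hn : n ≤ 2) (hf : ContMDiff 𝓘(ℝ, E) 𝓘(ℝ, ℝ) (n + 1) f) :
    ContMDiff 𝓘(ℝ, E) 𝓘(ℝ, ℝ) n (lieDeriv X f) := by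
  have : LieGroup 𝓘(ℝ, E) (minSmoothness ℝ 3) G := by
    rw [minSmoothness_of_isRCLikeNormedField]
    infer_instance
  have : IsManifold 𝓘(ℝ, E) ∞ G := inferInstance
  have : IsManifold 𝓘(ℝ, E) (n + 1) G := IsManifold.of_le (n := ∞)
    ((add_le_add_left hn 1).trans (by
      norm_num
      exact WithTop.coe_le_coe.2 le_top))
  have hv : ContMDiff 𝓘(ℝ, E) (𝓘(ℝ, E).tangent) n
      (fun g : G => (⟨g, mulInvariantVectorField X g⟩ : TangentBundle 𝓘(ℝ, E) G)) :=
    (contMDiff_mulInvariantVectorField X).of_le (hn.trans le_minSmoothness)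
  exact (contMDiff_snd_tangentBundle_modelSpace ℝ 𝓘(ℝ, ℝ)).comp
    ((hf.contMDiff_tangentMap le_rfl).comp hv)

variable [FiniteDimensional ℝ E]

/-- Along the integral curve `γ` of `X`, differentiating `f ∘ γ` amounts to applying `X` to `f`, so
this is the one-variable estimate. -/
theorem abs_sub_taylor_lieExp_le [T2Space G] (X : GroupLieAlgebra 𝓘(ℝ, E) G) {f : G → ℝ}
    (hf : ContMDiff 𝓘(ℝ, E) 𝓘(ℝ, ℝ) 3 f) {C : ℝ}
    (hC : ∀ g, |lieDeriv X (lieDeriv X (lieDeriv X f)) g| ≤ C) :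
    |f (lieExp X) - f 1 - lieDeriv X f 1 - 1 / 2 * lieDeriv X (lieDeriv X f) 1| ≤ C := by
  have : CompleteSpace E := FiniteDimensional.complete ℝ E
  obtain ⟨γ, h0, hγ⟩ := exists_integralCurve X
  have h2 := contMDiff_lieDeriv X (n := 2) le_rfl (by norm_num; exact hf)
  have h1 := contMDiff_lieDeriv X (n := 1) (by norm_num) (by norm_num; exact h2)
  rw [lieExp_eq X h0 hγ, ← h0]
  exact norm_taylor_two_remainder_le (F := fun t => f (γ t))
    (hasDerivAt_comp_integralCurve hγ (hf.of_le (by norm_num)))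
    (hasDerivAt_comp_integralCurve hγ (h2.of_le (by norm_num)))
    (hasDerivAt_comp_integralCurve hγ h1) fun t => hC (γ t)

theorem lieDeriv_sum_smul_iterate_two {d : ℕ} (Y : Fin d → GroupLieAlgebra 𝓘(ℝ, E) G)
    (v : Fin d → ℝ) {f : G → ℝ} (hf : ContMDiff 𝓘(ℝ, E) 𝓘(ℝ, ℝ) 2 f) (g : G) :
    lieDeriv (∑ i, v i • Y i) (lieDeriv (∑ i, v i • Y i) f) g =
      ∑ i, ∑ j, v i * v j * lieDeriv (Y i) (lieDeriv (Y j) f) g := by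
  have : CompleteSpace E := FiniteDimensional.complete ℝ E
  have h1 : lieDeriv (∑ i, v i • Y i) f = fun g => ∑ j, v j * lieDeriv (Y j) f g :=
    funext fun g => lieDeriv_sum_smul_left _ _ _ _ _
  rw [lieDeriv_sum_smul_left, h1]
  refine Finset.sum_congr rfl fun i _ => ?_
  rw [lieDeriv_sum_mul _ _ _ fun j _ => ((contMDiff_lieDeriv (Y j) (n := 1) (by norm_num)
    (by norm_num; exact hf)).contMDiffAt).mdifferentiableAt one_ne_zero, Finset.mul_sum]
  exact Finset.sum_congr rfl fun j _ => by ring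

/-- Exhibits the third derivative as a cubic form in `v`, which makes the Taylor remainder `O(|v|³)`
uniformly in the direction. -/
theorem lieDeriv_sum_smul_iterate_three {d : ℕ} (Y : Fin d → GroupLieAlgebra 𝓘(ℝ, E) G)
    (v : Fin d → ℝ) {f : G → ℝ} (hf : ContMDiff 𝓘(ℝ, E) 𝓘(ℝ, ℝ) 3 f) (g : G) :
    lieDeriv (∑ i, v i • Y i) (lieDeriv (∑ i, v i • Y i) (lieDeriv (∑ i, v i • Y i) f)) g =
      ∑ k, v k * ∑ i, ∑ j, v i * v j * lieDeriv (Y i) (lieDeriv (Y j) (lieDeriv (Y k) f)) g := by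
  have : CompleteSpace E := FiniteDimensional.complete ℝ E
  have h2 : ∀ k, ContMDiff 𝓘(ℝ, E) 𝓘(ℝ, ℝ) 2 (lieDeriv (Y k) f) := fun k =>
    contMDiff_lieDeriv (Y k) le_rfl (by norm_num; exact hf)
  have hd : ∀ (h : G → ℝ) (_ : ContMDiff 𝓘(ℝ, E) 𝓘(ℝ, ℝ) 1 h) (g : G),
      MDifferentiableAt 𝓘(ℝ, E) 𝓘(ℝ, ℝ) h g := fun h hh g =>
    hh.contMDiffAt.mdifferentiableAt one_ne_zero
  have e1 : lieDeriv (∑ i, v i • Y i) f = fun g => ∑ k, v k * lieDeriv (Y k) f g :=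
    funext fun g => lieDeriv_sum_smul_left _ _ _ _ _
  have e2 : lieDeriv (∑ i, v i • Y i) (fun g => ∑ k, v k * lieDeriv (Y k) f g) =
      fun g => ∑ k, v k * lieDeriv (∑ i, v i • Y i) (lieDeriv (Y k) f) g :=
    funext fun g => lieDeriv_sum_mul _ _ _ fun k _ => hd _ ((h2 k).of_le (by norm_num)) g
  rw [e1, e2, lieDeriv_sum_mul _ _ _ fun k _ => hd _ (contMDiff_lieDeriv _ (n := 1) (by norm_num)
    (by norm_num; exact h2 k)) g]
  exact Finset.sum_congr rfl fun k _ => by rw [lieDeriv_sum_smul_iterate_two Y v (h2 k)]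

/-- Taylor's formula of second order in exponential coordinates. -/
theorem exists_abs_sub_taylor_lieExp_le [T2Space G] {d : ℕ} (Y : Fin d → GroupLieAlgebra 𝓘(ℝ, E) G)
    {f : G → ℝ} (hf : ContMDiff 𝓘(ℝ, E) 𝓘(ℝ, ℝ) 3 f) (hc : HasCompactSupport f) :
    ∃ C, 0 ≤ C ∧ ∀ v : Fin d → ℝ,
      |f (lieExp (∑ i, v i • Y i)) - f 1 - ∑ i, v i * lieDeriv (Y i) f 1
        - 1 / 2 * ∑ i, ∑ j, v i * v j * lieDeriv (Y i) (lieDeriv (Y j) f) 1| ≤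
      C * (∑ i, |v i|) ^ 3 := by
  have : CompleteSpace E := FiniteDimensional.complete ℝ E
  have bdd : ∀ i j k, ∃ M, 0 ≤ M ∧
      ∀ g, |lieDeriv (Y i) (lieDeriv (Y j) (lieDeriv (Y k) f)) g| ≤ M := by
    intro i j k
    have h2 := contMDiff_lieDeriv (Y k) (n := 2) le_rfl (by norm_num; exact hf)
    have h1 := contMDiff_lieDeriv (Y j) (n := 1) (by norm_num) (by norm_num; exact h2)
    have h0 := contMDiff_lieDeriv (Y i) (n := 0) (by norm_num) (by norm_num; exact h1)
    obtain ⟨M, hM⟩ := (hasCompactSupport_lieDeriv (Y i) (hasCompactSupport_lieDeriv (Y j)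
      (hasCompactSupport_lieDeriv (Y k) hc))).exists_bound_of_continuous h0.continuous
    exact ⟨M, (norm_nonneg _).trans (hM 1), hM⟩
  choose M hM0 hM using bdd
  set C := ∑ i, ∑ j, ∑ k, M i j k with hC
  have hMC : ∀ i j k, M i j k ≤ C := fun i j k =>
    ((Finset.single_le_sum (fun k _ => hM0 i j k) (Finset.mem_univ k)).trans
      (Finset.single_le_sum (f := fun j => ∑ k, M i j k)
        (fun j _ => Finset.sum_nonneg fun k _ => hM0 i j k) (Finset.mem_univ j))).trans
      (Finset.single_le_sum (f := fun i => ∑ j, ∑ k, M i j k)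
        (fun i _ => Finset.sum_nonneg fun j _ => Finset.sum_nonneg fun k _ => hM0 i j k)
        (Finset.mem_univ i))
  refine ⟨C, Finset.sum_nonneg fun i _ => Finset.sum_nonneg fun j _ =>
    Finset.sum_nonneg fun k _ => hM0 i j k, fun v => ?_⟩
  rw [← lieDeriv_sum_smul_left, ← lieDeriv_sum_smul_iterate_two Y v (hf.of_le (by norm_num))]
  refine abs_sub_taylor_lieExp_le _ hf fun g => ?_
  rw [lieDeriv_sum_smul_iterate_three Y v hf]
  have e : C * (∑ i, |v i|) ^ 3 = ∑ k, |v k| * ∑ i, ∑ j, |v i| * |v j| * C := by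
    rw [← Finset.sum_mul]
    simp_rw [← Finset.sum_mul, ← Finset.mul_sum]
    rw [← Finset.sum_mul]
    ring
  rw [e]
  refine (Finset.abs_sum_le_sum_abs _ _).trans (Finset.sum_le_sum fun k _ => ?_)
  rw [abs_mul]
  refine mul_le_mul_of_nonneg_left ?_ (abs_nonneg _)
  refine (Finset.abs_sum_le_sum_abs _ _).trans (Finset.sum_le_sum fun i _ => ?_)
  refine (Finset.abs_sum_le_sum_abs _ _).trans (Finset.sum_le_sum fun j _ => ?_)
  rw [abs_mul, abs_mul]
  exact mul_le_mul_of_nonneg_left ((hM i j k g).trans (hMC i j k)) (by positivity)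

end Taylor

end LieCourrege

namespace LieCourrege

/-! ### The representing measure away from the identity -/

section PositiveMaximumPrinciple

variable {E : Type*} [NormedAddCommGroup E] [NormedSpace ℝ E]
  {G : Type*} [TopologicalSpace G] [ChartedSpace E G]

/-- The product of a smooth function and a smooth compactly supported function. -/
def SmoothCc.mulLeft (u : G → ℝ) (hu : ContMDiff 𝓘(ℝ, E) 𝓘(ℝ, ℝ) ∞ u) (f : SmoothCc E G) :
    SmoothCc E G :=
  ⟨fun g => u g * (f : G → ℝ) g, hu.mul f.2.1, f.2.2.mul_left⟩

theorem exists_smoothCc_eq_one [FiniteDimensional ℝ E] [IsManifold 𝓘(ℝ, E) ∞ G] [T2Space G]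
    [SecondCountableTopology G] {K O : Set G} (hK : IsCompact K) (hO : IsOpen O) (h : K ⊆ O) :
    ∃ χ : SmoothCc E G, (∀ᶠ g in 𝓝ˢ K, (χ : G → ℝ) g = 1) ∧ tsupport (χ : G → ℝ) ⊆ O ∧
      ∀ g, (χ : G → ℝ) g ∈ Icc (0 : ℝ) 1 := by
  have : LocallyCompactSpace G := Manifold.locallyCompact_of_finiteDimensional 𝓘(ℝ, E)
  obtain ⟨L, hL, hKL, hLO⟩ := exists_compact_between hK hO h
  obtain ⟨f, hf1, hf0, hf⟩ := exists_contMDiffMap_one_nhds_of_subset_interior (n := ⊤) 𝓘(ℝ, E)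
    hK.isClosed hKL
  have hs : tsupport f ⊆ L := closure_minimal (fun g hg => by
    by_contra h
    exact hg (hf0 g h)) hL.isClosed
  exact ⟨⟨f, f.contMDiff, hL.of_isClosed_subset (isClosed_tsupport _) hs⟩, hf1, hs.trans hLO, hf⟩

variable [Group G]

/-- The function `-f` attains its supremum `0` at `1`. -/
theorem SatisfiesPMP.map_nonneg {T : SmoothCc E G →ₗ[ℝ] ℝ} (hT : SatisfiesPMP T) {f : SmoothCc E G}
    (h1 : (f : G → ℝ) 1 = 0) (hf : ∀ g, 0 ≤ (f : G → ℝ) g) : 0 ≤ T f := by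
  have h := hT (-f) ⟨by
      rintro _ ⟨g, rfl⟩
      simpa [h1] using hf g, fun b hb => hb ⟨1, rfl⟩⟩ (by simp [h1])
  rw [map_neg] at h
  linarith

theorem SatisfiesPMP.map_mono {T : SmoothCc E G →ₗ[ℝ] ℝ} (hT : SatisfiesPMP T) {f h : SmoothCc E G}
    (h1 : (f : G → ℝ) 1 = (h : G → ℝ) 1) (hfh : ∀ g, (f : G → ℝ) g ≤ (h : G → ℝ) g) :
    T f ≤ T h := by
  have := hT.map_nonneg (f := h - f) (by simp [h1]) (fun g => by simpa using hfh g)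
  rw [map_sub] at this
  linarith

open CompactlySupported in
/-- A functional on `C_c^∞(G)` which is nonnegative on the nonnegative functions vanishing at `1`
is given on the multiples of a weight `q` vanishing at `1` by a Radon measure. -/
theorem SatisfiesPMP.exists_measure_integral_eq [FiniteDimensional ℝ E] [IsManifold 𝓘(ℝ, E) ∞ G]
    [T2Space G] [SecondCountableTopology G] [MeasurableSpace G] [BorelSpace G]
    {T : SmoothCc E G →ₗ[ℝ] ℝ} (hT : SatisfiesPMP T) {q : G → ℝ}
    (hq : ContMDiff 𝓘(ℝ, E) 𝓘(ℝ, ℝ) ∞ q) (hq1 : q 1 = 0) (hq0 : ∀ g, 0 ≤ q g) :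
    ∃ ν : Measure G, IsFiniteMeasureOnCompacts ν ∧ ∀ (h : C_c(G, ℝ)) (f : SmoothCc E G),
      (∀ g, (f : G → ℝ) g = h g * q g) → T f = ∫ g, h g ∂ν := by
  have : LocallyCompactSpace G := Manifold.locallyCompact_of_finiteDimensional 𝓘(ℝ, E)
  let m : C_c(G, ℝ) →ₗ[ℝ] G → ℝ :=
    { toFun := fun h g => h g * q g
      map_add' := fun h k => by ext g; simp [add_mul]
      map_smul' := fun c h => by ext g; simp [mul_assoc] }
  let p : Submodule ℝ C_c(G, ℝ) := (SmoothCc E G).comap m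
  let t : p →ₗ[ℝ] ℝ := T ∘ₗ m.restrict (p := p) (q := SmoothCc E G) fun _ hh => hh
  let s : PointedCone ℝ C_c(G, ℝ) :=
    { carrier := {h | ∀ g, 0 ≤ h g}
      add_mem' := fun hh hk g => add_nonneg (hh g) (hk g)
      zero_mem' := fun g => le_rfl
      smul_mem' := fun c h hh g => mul_nonneg c.2 (hh g) }
  -- M. Riesz extension from `p`, the `h` with `h q` smooth. Cofinality holds because `p` contains
  -- the smooth cutoffs: a large multiple of one equal to `1` on the support of `y` dominates `-y`.
  obtain ⟨Λ, hΛ, hpos⟩ := riesz_extension s ⟨p, t⟩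
    (fun h hh => hT.map_nonneg (by
        change (h : C_c(G, ℝ)) 1 * q 1 = 0
        rw [hq1, mul_zero]) fun g => mul_nonneg (hh g) (hq0 g))
    (fun y => by
      obtain ⟨χ, hχ1, -, hχ⟩ := exists_smoothCc_eq_one (E := E) y.hasCompactSupport isOpen_univ
        (subset_univ _)
      obtain ⟨M, hM⟩ := y.hasCompactSupport.exists_bound_of_continuous y.continuous
      let z : C_c(G, ℝ) := ⟨⟨χ, χ.2.1.continuous⟩, χ.2.2⟩
      refine ⟨⟨M • z, ?_⟩, fun g => ?_⟩
      · refine p.smul_mem M ?_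
        change (fun g => (χ : G → ℝ) g * q g) ∈ SmoothCc E G
        exact ⟨χ.2.1.mul hq, χ.2.2.mul_right⟩
      · change 0 ≤ M * (χ : G → ℝ) g + y g
        have hb := neg_le_of_abs_le (hM g)
        by_cases hg : g ∈ tsupport y
        · rw [hχ1.self_of_nhdsSet g hg]
          linarith
        · rw [image_eq_zero_of_notMem_tsupport hg, add_zero]
          exact mul_nonneg ((norm_nonneg _).trans (hM g)) (hχ g).1)
  let Λ' : C_c(G, ℝ) →ₚ[ℝ] ℝ := PositiveLinearMap.mk₀ Λ fun h hh => hpos h hh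
  refine ⟨RealRMK.rieszMeasure Λ', inferInstance, fun h f hf => ?_⟩
  have hf' : m h = f := funext fun g => (hf g).symm
  have hh : h ∈ p := by
    change m h ∈ SmoothCc E G
    rw [hf']
    exact f.2
  rw [RealRMK.integral_rieszMeasure Λ' h]
  refine Eq.trans ?_ (hΛ ⟨h, hh⟩).symm
  exact congrArg T (Subtype.ext hf'.symm)

/-- The measure representing a functional with the positive maximum principle on the functions
which vanish at `1` faster than a weight `q`. -/
theorem SatisfiesPMP.exists_measure_integral_eq_of_tendsto [FiniteDimensional ℝ E]
    [IsManifold 𝓘(ℝ, E) ∞ G] [T2Space G] [SecondCountableTopology G] [MeasurableSpace G]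
    [BorelSpace G] {T : SmoothCc E G →ₗ[ℝ] ℝ} (hT : SatisfiesPMP T) {q : G → ℝ}
    (hq : ContMDiff 𝓘(ℝ, E) 𝓘(ℝ, ℝ) ∞ q) (hq1 : q 1 = 0) (hq0 : ∀ g ≠ 1, 0 < q g) :
    ∃ μ : Measure G, μ {1} = 0 ∧ ∀ f : SmoothCc E G,
      (f : G → ℝ) 1 = 0 → Filter.Tendsto (fun g => (f : G → ℝ) g / q g) (𝓝 1) (𝓝 0) →
        Integrable (f : G → ℝ) μ ∧ T f = ∫ g, (f : G → ℝ) g ∂μ := by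
  have hq0' : ∀ g, 0 ≤ q g := fun g => by
    rcases eq_or_ne g 1 with rfl | h
    exacts [hq1.ge, (hq0 g h).le]
  obtain ⟨ν, hν, hνT⟩ := hT.exists_measure_integral_eq hq hq1 hq0'
  have hm : Measurable fun g => ENNReal.ofReal (q g)⁻¹ :=
    hq.continuous.measurable.inv.ennreal_ofReal
  -- A possible atom of `ν` at `1` is discarded; it does not affect `f = o(q)`, for which `f / q`
  -- vanishes at `1`.
  refine ⟨(ν.restrict {1}ᶜ).withDensity fun g => ENNReal.ofReal (q g)⁻¹, ?_, fun f h1 hf => ?_⟩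
  · exact withDensity_absolutelyContinuous _ _ (by simp)
  -- The convention `y / 0 = 0` assigns to the quotient at `1` exactly its limit.
  · have hc : Continuous fun g => (f : G → ℝ) g / q g := by
      refine continuous_iff_continuousAt.2 fun g => ?_
      rcases eq_or_ne g 1 with rfl | h
      · rw [ContinuousAt, hq1, div_zero]
        exact hf
      · exact f.2.1.continuous.continuousAt.div hq.continuous.continuousAt (hq0 g h).ne'
    have hs : HasCompactSupport fun g => (f : G → ℝ) g / q g := by
      simp_rw [div_eq_mul_inv]
      exact f.2.2.mul_right
    have he : (fun g => (ENNReal.ofReal (q g)⁻¹).toReal • (f : G → ℝ) g) =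
        fun g => (f : G → ℝ) g / q g := funext fun g => by
      rw [ENNReal.toReal_ofReal (inv_nonneg.2 (hq0' g)), smul_eq_mul, div_eq_mul_inv, mul_comm]
    have hfin : ∀ᵐ g ∂ν.restrict {1}ᶜ, ENNReal.ofReal (q g)⁻¹ < ⊤ :=
      Filter.Eventually.of_forall fun _ => ENNReal.ofReal_lt_top
    refine ⟨?_, ?_⟩
    · rw [integrable_withDensity_iff_integrable_smul' hm hfin, he]
      exact (hc.integrable_of_hasCompactSupport hs).restrict
    · rw [integral_withDensity_eq_integral_toReal_smul hm hfin, he,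
        setIntegral_eq_integral_of_forall_compl_eq_zero fun g hg => ?_]
      · refine hνT ⟨⟨_, hc⟩, hs⟩ f fun g => ?_
        rcases eq_or_ne g 1 with rfl | h
        · rw [hq1, mul_zero, h1]
        · exact (div_mul_cancel₀ _ (hq0 g h).ne').symm
      · rw [notMem_compl_iff, mem_singleton_iff] at hg
        rw [hg, hq1, div_zero]

/-- An upper bound for the integral of a nonnegative function against a measure representing a
functional on the functions vanishing near `1`. -/
theorem lintegral_ofReal_le_of_forall_map_le [FiniteDimensional ℝ E]
    [IsManifold 𝓘(ℝ, E) ∞ G] [T2Space G] [SecondCountableTopology G] [MeasurableSpace G]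
    [BorelSpace G] {T : SmoothCc E G →ₗ[ℝ] ℝ} {μ : Measure G} (hμ1 : μ {1} = 0)
    (hμ : ∀ f : SmoothCc E G, (f : G → ℝ) =ᶠ[𝓝 1] 0 →
      Integrable (f : G → ℝ) μ ∧ T f = ∫ g, (f : G → ℝ) g ∂μ)
    {u : G → ℝ} (hu : ContMDiff 𝓘(ℝ, E) 𝓘(ℝ, ℝ) ∞ u) (hu0 : ∀ g, 0 ≤ u g) {M : ℝ}
    (hM : ∀ v : SmoothCc E G, (v : G → ℝ) =ᶠ[𝓝 1] 0 →
      (∀ g, 0 ≤ (v : G → ℝ) g) → (∀ g, (v : G → ℝ) g ≤ u g) → T v ≤ M) :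
    ∫⁻ g, ENNReal.ofReal (u g) ∂μ ≤ ENNReal.ofReal M := by
  have : LocallyCompactSpace G := Manifold.locallyCompact_of_finiteDimensional 𝓘(ℝ, E)
  obtain ⟨W, hW⟩ := (𝓝 (1 : G)).exists_antitone_basis
  let C := CompactExhaustion.choice G
  -- Compact sets increasing to `G \ {1}`. Cutting `u` off by `θ` equal to `1` near `K n` and
  -- supported off `1` gives an admissible `v`, and monotone convergence removes the cutoff.
  let K : ℕ → Set G := fun n => C n \ interior (W n)
  have hKm : Monotone K := fun m n hmn =>
    sdiff_le_sdiff (C.subset hmn) (interior_mono (hW.antitone hmn))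
  have hKc : ∀ n, IsCompact (K n) := fun n => (C.isCompact n).diff isOpen_interior
  have hK1 : ∀ n, K n ⊆ {1}ᶜ := fun n g hg h => hg.2 (by
    rw [mem_singleton_iff.1 h]
    exact mem_interior_iff_mem_nhds.2 (hW.mem n))
  have hKU : ({1}ᶜ : Set G) ⊆ ⋃ n, K n := fun g hg => by
    obtain ⟨n, hn⟩ := mem_iUnion.1 (C.iUnion_eq.ge (mem_univ g))
    obtain ⟨k, hk⟩ := hW.mem_iff.1 (isOpen_compl_singleton.mem_nhds (Ne.symm hg) :
      ({g}ᶜ : Set G) ∈ 𝓝 1)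
    refine mem_iUnion.2 ⟨max n k, C.subset (le_max_left _ _) hn, fun h => ?_⟩
    exact hk (hW.antitone (le_max_right _ _) (interior_subset h)) rfl
  have hr : μ.restrict (⋃ n, K n) = μ := Measure.restrict_eq_self_of_ae_mem <|
    (measure_eq_zero_iff_ae_notMem.1 hμ1).mono fun g hg => hKU hg
  rw [← hr, setLIntegral_iUnion_of_directed _ hKm.directed_le]
  refine iSup_le fun n => ?_
  obtain ⟨θ, hθ1, hθs, hθ⟩ := exists_smoothCc_eq_one (E := E) (hKc n) isOpen_compl_singleton (hK1 n)
  let v := SmoothCc.mulLeft u hu θ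
  have hv : (v : G → ℝ) =ᶠ[𝓝 1] 0 := by
    have : (θ : G → ℝ) =ᶠ[𝓝 1] 0 := notMem_tsupport_iff_eventuallyEq.1 fun h => hθs h rfl
    filter_upwards [this] with g hg
    change u g * (θ : G → ℝ) g = 0
    rw [hg, Pi.zero_apply, mul_zero]
  have hv0 : ∀ g, 0 ≤ (v : G → ℝ) g := fun g => mul_nonneg (hu0 g) (hθ g).1
  calc ∫⁻ g in K n, ENNReal.ofReal (u g) ∂μ
      ≤ ∫⁻ g in K n, ENNReal.ofReal ((v : G → ℝ) g) ∂μ := by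
        refine setLIntegral_mono' (hKc n).measurableSet fun g hg => le_of_eq ?_
        change _ = ENNReal.ofReal (u g * (θ : G → ℝ) g)
        rw [hθ1.self_of_nhdsSet g hg, mul_one]
    _ ≤ ∫⁻ g, ENNReal.ofReal ((v : G → ℝ) g) ∂μ := setLIntegral_le_lintegral _ _
    _ = ENNReal.ofReal (T v) := by
        rw [(hμ v hv).2, ofReal_integral_eq_lintegral_ofReal (hμ v hv).1
          (Filter.Eventually.of_forall hv0)]
    _ ≤ ENNReal.ofReal M := ENNReal.ofReal_le_ofReal
        (hM v hv hv0 fun g => mul_le_of_le_one_right (hu0 g) (hθ g).2)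

end PositiveMaximumPrinciple

end LieCourrege

namespace LieCourrege

/-! ### Canonical coordinates and the weight -/

section Coordinates

variable {E : Type*} [NormedAddCommGroup E] [NormedSpace ℝ E] [FiniteDimensional ℝ E]
  {G : Type*} [TopologicalSpace G] [ChartedSpace E G] [Group G] [LieGroup 𝓘(ℝ, E) ∞ G] [T2Space G]
  {d : ℕ}

theorem lieExp_zero : lieExp (0 : GroupLieAlgebra 𝓘(ℝ, E) G) = 1 := by
  refine lieExp_eq (γ := fun _ => 1) 0 rfl fun t => ?_
  refine (hasMFDerivAt_const (1 : G) t).congr_mfderiv ?_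
  ext
  change (0 : E) = (1 : ℝ) • (mfderiv 𝓘(ℝ, E) 𝓘(ℝ, E) ((1 : G) * ·) (1 : G) : E →L[ℝ] E) 0
  rw [map_zero, smul_zero]
  rfl

theorem IsCanonicalCoord.eq_one_of_forall_eq_zero
    {Y : Module.Basis (Fin d) ℝ (GroupLieAlgebra 𝓘(ℝ, E) G)} {U : Set G} {x : Fin d → SmoothCc E G}
    (hx : IsCanonicalCoord Y U x) {g : G} (hg : g ∈ U) (h : ∀ i, (x i : G → ℝ) g = 0) : g = 1 := by
  rw [← hx.exp_eq g hg]
  simp only [h, zero_smul, Finset.sum_const_zero]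
  exact lieExp_zero

/-- A weight which vanishes only at `1` and dominates the square of the norm of canonical
coordinates. -/
theorem IsCanonicalCoord.exists_weight [SecondCountableTopology G]
    {Y : Module.Basis (Fin d) ℝ (GroupLieAlgebra 𝓘(ℝ, E) G)} {U : Set G} {x : Fin d → SmoothCc E G}
    (hx : IsCanonicalCoord Y U x) : ∃ q : G → ℝ, ContMDiff 𝓘(ℝ, E) 𝓘(ℝ, ℝ) ∞ q ∧ q 1 = 0 ∧
      (∀ g ≠ 1, 0 < q g) ∧ ∀ g, ∑ i, (x i : G → ℝ) g ^ 2 ≤ q g := by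
  have : IsManifold 𝓘(ℝ, E) ∞ G := inferInstance
  obtain ⟨χ, hχ1, hχs, hχ⟩ := exists_smoothCc_eq_one (E := E) isCompact_singleton hx.isOpen
    (singleton_subset_iff.2 hx.one_mem)
  have hs0 : ∀ g, 0 ≤ ∑ i, (x i : G → ℝ) g ^ 2 := fun g => Finset.sum_nonneg fun i _ => sq_nonneg _
  -- The `x i` may vanish simultaneously outside `U`; there `χ = 0`, and the term `1 - χ` keeps the
  -- weight positive.
  refine ⟨fun g => ∑ i, (x i : G → ℝ) g ^ 2 + (1 - (χ : G → ℝ) g), ?_, ?_, fun g hg => ?_,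
    fun g => ?_⟩
  · exact (contMDiff_finsetSum fun i _ => (x i).2.1.pow 2).add (contMDiff_const.sub χ.2.1)
  · simp [hx.map_one, hχ1.self_of_nhdsSet 1 rfl]
  · refine (add_nonneg (hs0 g) (sub_nonneg.2 (hχ g).2)).lt_of_ne fun h => hg ?_
    have h1 : (χ : G → ℝ) g = 1 := by linarith [hs0 g, (hχ g).2]
    have h2 : ∑ i, (x i : G → ℝ) g ^ 2 = 0 := by linarith [hs0 g, (hχ g).2]
    refine hx.eq_one_of_forall_eq_zero (hχs (subset_tsupport _ ?_)) fun i => ?_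
    · rw [Function.mem_support, h1]
      exact one_ne_zero
    · exact pow_eq_zero_iff two_ne_zero |>.1
        ((Finset.sum_eq_zero_iff_of_nonneg fun i _ => sq_nonneg _).1 h2 i (Finset.mem_univ i))
  · exact le_add_of_nonneg_right (sub_nonneg.2 (hχ g).2)

/-- The remainder in Taylor's formula of second order in canonical coordinates is negligible with
respect to any weight dominating the square of the norm of the coordinates. -/
theorem IsCanonicalCoord.tendsto_taylor_remainder_div
    {Y : Module.Basis (Fin d) ℝ (GroupLieAlgebra 𝓘(ℝ, E) G)} {U : Set G} {x : Fin d → SmoothCc E G}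
    (hx : IsCanonicalCoord Y U x) {q : G → ℝ} (hq : ∀ g, ∑ i, (x i : G → ℝ) g ^ 2 ≤ q g)
    (f : SmoothCc E G) :
    Filter.Tendsto (fun g => ((f : G → ℝ) g - (f : G → ℝ) 1
      - ∑ i, (x i : G → ℝ) g * lieDeriv (Y i) (f : G → ℝ) 1
      - 1 / 2 * ∑ i, ∑ j, (x i : G → ℝ) g * (x j : G → ℝ) g *
          lieDeriv (Y i) (lieDeriv (Y j) (f : G → ℝ)) 1) / q g) (𝓝 1) (𝓝 0) := by
  obtain ⟨C, hC0, hC⟩ := exists_abs_sub_taylor_lieExp_le (f := (f : G → ℝ)) Y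
    (f.2.1.of_le (WithTop.coe_le_coe.2 le_top)) f.2.2
  have ht : Filter.Tendsto (fun g => C * d * ∑ i, |(x i : G → ℝ) g|) (𝓝 1) (𝓝 0) := by
    have : Continuous fun g => C * d * ∑ i, |(x i : G → ℝ) g| :=
      continuous_const.mul (continuous_finsetSum _ fun i _ => (x i).2.1.continuous.abs)
    simpa [hx.map_one] using this.tendsto 1
  refine squeeze_zero_norm' ?_ ht
  filter_upwards [hx.isOpen.mem_nhds hx.one_mem] with g hg
  have hs : 0 ≤ ∑ i, |(x i : G → ℝ) g| := Finset.sum_nonneg fun i _ => abs_nonneg _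
  have hq0 : 0 ≤ q g := (Finset.sum_nonneg fun i _ => sq_nonneg _).trans (hq g)
  have h := hC fun i => (x i : G → ℝ) g
  rw [hx.exp_eq g hg] at h
  rw [Real.norm_eq_abs, abs_div, abs_of_nonneg hq0]
  refine div_le_of_le_mul₀ hq0 (by positivity) (h.trans ?_)
  -- Cauchy–Schwarz absorbs two of the three powers into `q`; the remaining one tends to `0`.
  have hcs : (∑ i, |(x i : G → ℝ) g|) ^ 2 ≤ d * ∑ i, (x i : G → ℝ) g ^ 2 := by
    simpa using sq_sum_le_card_mul_sum_sq (s := Finset.univ) (f := fun i => |(x i : G → ℝ) g|)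
  calc C * (∑ i, |(x i : G → ℝ) g|) ^ 3
      = C * (∑ i, |(x i : G → ℝ) g|) * (∑ i, |(x i : G → ℝ) g|) ^ 2 := by ring
    _ ≤ C * (∑ i, |(x i : G → ℝ) g|) * (d * q g) := by
        gcongr
        exact hcs.trans (mul_le_mul_of_nonneg_left (hq g) d.cast_nonneg)
    _ = C * d * (∑ i, |(x i : G → ℝ) g|) * q g := by ring

end Coordinates

/-! ### One-sided bounds and the Lévy property -/

section LevyMeasure

variable {E : Type*} [NormedAddCommGroup E] [NormedSpace ℝ E] [FiniteDimensional ℝ E]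
  {G : Type*} [TopologicalSpace G] [ChartedSpace E G] [Group G] [T2Space G]
  [SecondCountableTopology G] [MeasurableSpace G] [BorelSpace G]
  {T : SmoothCc E G →ₗ[ℝ] ℝ} {μ : Measure G}

/-- Truncations of `p` vanishing near `1` lie below `p`, so monotonicity of `T` bounds their
integrals. The defect `T p - ∫ p` will be the second-order part. -/
theorem SatisfiesPMP.integrable_and_integral_le [IsManifold 𝓘(ℝ, E) ∞ G] (hT : SatisfiesPMP T)
    (hμ1 : μ {1} = 0)
    (hμ : ∀ f : SmoothCc E G, (f : G → ℝ) =ᶠ[𝓝 1] 0 →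
      Integrable (f : G → ℝ) μ ∧ T f = ∫ g, (f : G → ℝ) g ∂μ)
    {p : SmoothCc E G} (hp1 : (p : G → ℝ) 1 = 0) (hp : ∀ g, 0 ≤ (p : G → ℝ) g) :
    Integrable (p : G → ℝ) μ ∧ ∫ g, (p : G → ℝ) g ∂μ ≤ T p := by
  have h := lintegral_ofReal_le_of_forall_map_le hμ1 hμ p.2.1 hp (M := T p)
    fun v hv _ hvp => hT.map_mono (by rw [hv.self_of_nhds, hp1, Pi.zero_apply]) hvp
  have hi : Integrable (p : G → ℝ) μ :=
    ⟨p.2.1.continuous.aestronglyMeasurable, (hasFiniteIntegral_iff_ofReal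
      (Filter.Eventually.of_forall hp)).2 (h.trans_lt ENNReal.ofReal_lt_top)⟩
  rw [← ofReal_integral_eq_lintegral_ofReal hi (Filter.Eventually.of_forall hp),
    ENNReal.ofReal_le_ofReal_iff (hT.map_nonneg hp1 hp)] at h
  exact ⟨hi, h⟩

/-- As `1 - χ` need not have compact support, `T` is applied instead to `v + χ`, whose maximum `1`
is attained at `1` whenever `v ≤ 1 - χ` and `v(1) = 0`. The defect will be `c`. -/
theorem SatisfiesPMP.integrable_one_sub_and_integral_le [IsManifold 𝓘(ℝ, E) ∞ G]
    (hT : SatisfiesPMP T) (hμ1 : μ {1} = 0)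
    (hμ : ∀ f : SmoothCc E G, (f : G → ℝ) =ᶠ[𝓝 1] 0 →
      Integrable (f : G → ℝ) μ ∧ T f = ∫ g, (f : G → ℝ) g ∂μ)
    {χ : SmoothCc E G} (hχ1 : (χ : G → ℝ) 1 = 1) (hχ : ∀ g, (χ : G → ℝ) g ≤ 1) :
    Integrable (fun g => 1 - (χ : G → ℝ) g) μ ∧ ∫ g, (1 - (χ : G → ℝ) g) ∂μ ≤ -T χ := by
  have hpmp : ∀ v : SmoothCc E G, (v : G → ℝ) 1 = 0 →
      (∀ g, (v : G → ℝ) g ≤ 1 - (χ : G → ℝ) g) → T v ≤ -T χ := fun v hv1 hv => by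
    have h1 : ((v + χ : SmoothCc E G) : G → ℝ) 1 = 1 := by simp [hv1, hχ1]
    have := hT (v + χ) ⟨by
      rintro _ ⟨g, rfl⟩
      rw [h1]
      change (v : G → ℝ) g + (χ : G → ℝ) g ≤ 1
      linarith [hv g], fun b hb => hb ⟨1, rfl⟩⟩ (h1.symm ▸ zero_le_one)
    rw [map_add] at this
    linarith
  have h0 : ∀ g, 0 ≤ 1 - (χ : G → ℝ) g := fun g => sub_nonneg.2 (hχ g)
  have h := lintegral_ofReal_le_of_forall_map_le hμ1 hμ (contMDiff_const.sub χ.2.1) h0 (M := -T χ)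
    fun v hv _ hvp => hpmp v hv.self_of_nhds hvp
  have hi : Integrable (fun g => 1 - (χ : G → ℝ) g) μ :=
    ⟨(continuous_const.sub χ.2.1.continuous).aestronglyMeasurable, (hasFiniteIntegral_iff_ofReal
      (Filter.Eventually.of_forall h0)).2 (h.trans_lt ENNReal.ofReal_lt_top)⟩
  rw [← ofReal_integral_eq_lintegral_ofReal hi (Filter.Eventually.of_forall h0),
    ENNReal.ofReal_le_ofReal_iff (by simpa using hpmp 0 rfl (by simpa using h0))] at h
  exact ⟨hi, h⟩

theorem SatisfiesPMP.measure_compl_lt_top [IsManifold 𝓘(ℝ, E) ∞ G] (hT : SatisfiesPMP T)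
    (hμ1 : μ {1} = 0)
    (hμ : ∀ f : SmoothCc E G, (f : G → ℝ) =ᶠ[𝓝 1] 0 →
      Integrable (f : G → ℝ) μ ∧ T f = ∫ g, (f : G → ℝ) g ∂μ)
    {U : Set G} (hU : IsOpen U) (h1 : (1 : G) ∈ U) : μ Uᶜ < ⊤ := by
  obtain ⟨χ, hχ1, hχs, hχ⟩ := exists_smoothCc_eq_one (E := E) isCompact_singleton hU
    (singleton_subset_iff.2 h1)
  obtain ⟨hi, -⟩ := hT.integrable_one_sub_and_integral_le hμ1 hμ (hχ1.self_of_nhdsSet 1 rfl)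
    fun g => (hχ g).2
  refine (measure_mono fun g hg => ?_).trans_lt (hi.measure_norm_ge_lt_top one_pos)
  have : (χ : G → ℝ) g = 0 := image_eq_zero_of_notMem_tsupport fun h => hg (hχs h)
  simp [this]

/-- The bounds do not involve the weight, so they apply to arbitrary canonical coordinates through
`p = ∑ x_i²`. -/
theorem SatisfiesPMP.isLevyMeasure [LieGroup 𝓘(ℝ, E) ∞ G] (hT : SatisfiesPMP T) (hμ1 : μ {1} = 0)
    (hμ : ∀ f : SmoothCc E G, (f : G → ℝ) =ᶠ[𝓝 1] 0 →
      Integrable (f : G → ℝ) μ ∧ T f = ∫ g, (f : G → ℝ) g ∂μ)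
    {d : ℕ} (Y : Module.Basis (Fin d) ℝ (GroupLieAlgebra 𝓘(ℝ, E) G)) : IsLevyMeasure Y μ := by
  have : IsManifold 𝓘(ℝ, E) ∞ G := inferInstance
  refine ⟨hμ1, fun U x hx => ?_, fun U x hx => hT.measure_compl_lt_top hμ1 hμ hx.isOpen hx.one_mem⟩
  let p : SmoothCc E G := ∑ i, SmoothCc.mulLeft _ (x i).2.1 (x i)
  have hp : ∀ g, (p : G → ℝ) g = ∑ i, (x i : G → ℝ) g ^ 2 := fun g => by
    simp [p, SmoothCc.mulLeft, sq]
  have hp0 : ∀ g, 0 ≤ (p : G → ℝ) g := fun g => by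
    rw [hp]
    exact Finset.sum_nonneg fun i _ => sq_nonneg _
  have hi := (hT.integrable_and_integral_le hμ1 hμ (p := p) (by simp [hp, hx.map_one]) hp0).1
  simp_rw [← hp]
  exact (setLIntegral_le_lintegral _ _).trans_lt
    ((hasFiniteIntegral_iff_ofReal (Filter.Eventually.of_forall hp0)).1 hi.2)

end LevyMeasure

end LieCourrege

open LieCourrege

/-! ### Assembly of the formula -/

theorem mainTheorem2 {E : Type*} [NormedAddCommGroup E] [NormedSpace ℝ E] [FiniteDimensional ℝ E]
    {G : Type*} [TopologicalSpace G] [ChartedSpace E G] [Group G] [LieGroup 𝓘(ℝ, E) ∞ G]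
    [T2Space G] [SecondCountableTopology G] [MeasurableSpace G] [BorelSpace G]
    {d : ℕ} (Y : Module.Basis (Fin d) ℝ (GroupLieAlgebra 𝓘(ℝ, E) G))
    (U : Set G) (x : Fin d → SmoothCc E G) (hx : IsCanonicalCoord Y U x)
    (T : SmoothCc E G →ₗ[ℝ] ℝ) (hT : SatisfiesPMP T) :
    ∃ (a : Matrix (Fin d) (Fin d) ℝ) (b : Fin d → ℝ) (c : ℝ) (μ : Measure G),
      a.IsSymm ∧ a.PosSemidef ∧ 0 ≤ c ∧ IsLevyMeasure Y μ ∧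
      ∀ f : SmoothCc E G,
        IntegrableOn (fun g => (f : G → ℝ) g - (f : G → ℝ) 1
          - ∑ i, (x i : G → ℝ) g * lieDeriv (Y i) (f : G → ℝ) 1) {1}ᶜ μ ∧
        T f = ∑ i, ∑ j, a i j * lieDeriv (Y i) (lieDeriv (Y j) (f : G → ℝ)) 1
          + ∑ i, b i * lieDeriv (Y i) (f : G → ℝ) 1
          - c * (f : G → ℝ) 1
          + ∫ g in {1}ᶜ, ((f : G → ℝ) g - (f : G → ℝ) 1
              - ∑ i, (x i : G → ℝ) g * lieDeriv (Y i) (f : G → ℝ) 1) ∂μ := by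
  have : IsManifold 𝓘(ℝ, E) ∞ G := inferInstance
  obtain ⟨q, hq, hq1, hq0, hxq⟩ := hx.exists_weight
  obtain ⟨μ, hμ1, hμq⟩ := hT.exists_measure_integral_eq_of_tendsto hq hq1 hq0
  have hμ : ∀ f : SmoothCc E G, (f : G → ℝ) =ᶠ[𝓝 1] 0 →
      Integrable (f : G → ℝ) μ ∧ T f = ∫ g, (f : G → ℝ) g ∂μ := fun f hf =>
    hμq f hf.self_of_nhds <| (Filter.tendsto_congr' (hf.mono fun g hg => by
      rw [hg, Pi.zero_apply, zero_div])).2 tendsto_const_nhds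
  obtain ⟨χ, hχ1, -, hχ⟩ := exists_smoothCc_eq_one (E := E) (isCompact_singleton (x := (1 : G)))
    isOpen_univ (subset_univ _)
  have hχ1' : (χ : G → ℝ) 1 = 1 := hχ1.self_of_nhdsSet 1 rfl
  obtain ⟨hχi, hχT⟩ := hT.integrable_one_sub_and_integral_le hμ1 hμ hχ1' fun g => (hχ g).2
  let xx : Fin d → Fin d → SmoothCc E G := fun i j => SmoothCc.mulLeft _ (x i).2.1 (x j)
  have hxx : ∀ i j g, (xx i j : G → ℝ) g = (x i : G → ℝ) g * (x j : G → ℝ) g := fun _ _ _ => rfl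
  have hsq : ∀ i, Integrable (xx i i : G → ℝ) μ := fun i =>
    (hT.integrable_and_integral_le hμ1 hμ (by rw [hxx, hx.map_one, zero_mul])
      fun g => mul_self_nonneg _).1
  have hxxi : ∀ i j, Integrable (xx i j : G → ℝ) μ := fun i j =>
    ((hsq i).add (hsq j)).mono' (xx i j).2.1.continuous.aestronglyMeasurable <|
      Filter.Eventually.of_forall fun g => by
        rw [Real.norm_eq_abs, Pi.add_apply, hxx, hxx, hxx, abs_le]
        constructor <;>
          nlinarith [mul_self_nonneg ((x i : G → ℝ) g + (x j : G → ℝ) g),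
            mul_self_nonneg ((x i : G → ℝ) g - (x j : G → ℝ) g),
            mul_self_nonneg ((x i : G → ℝ) g), mul_self_nonneg ((x j : G → ℝ) g)]
  have hxxc : ∀ i j, xx i j = xx j i := fun i j => Subtype.ext (funext fun g => mul_comm _ _)
  -- Half the defect on `x_i x_j`; the factor is Taylor's `1 / 2`.
  let a : Matrix (Fin d) (Fin d) ℝ := Matrix.of fun i j =>
    1 / 2 * (T (xx i j) - ∫ g, (xx i j : G → ℝ) g ∂μ)
  have ha : ∀ i j, a i j = 1 / 2 * (T (xx i j) - ∫ g, (xx i j : G → ℝ) g ∂μ) := fun _ _ => rfl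
  have has : a.IsSymm := Matrix.IsSymm.ext fun i j => by rw [ha, ha, hxxc]
  have hr : μ.restrict {1}ᶜ = μ := Measure.restrict_eq_self_of_ae_mem <|
    measure_eq_zero_iff_ae_notMem.1 hμ1
  refine ⟨a, fun i => T (x i), -(T χ + ∫ g, (1 - (χ : G → ℝ) g) ∂μ), μ, has,
    .of_dotProduct_mulVec_nonneg (by
      rwa [Matrix.IsHermitian, Matrix.conjTranspose_eq_transpose_of_trivial]) fun ξ => ?_,
    by linarith,
    hT.isLevyMeasure hμ1 hμ Y, fun f => ?_⟩
  -- The quadratic form of `a` at `ξ` is half the defect on `(∑ ξ_i x_i)²`, hence nonnegative.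
  · let p : SmoothCc E G := ∑ i, ∑ j, (ξ i * ξ j) • xx i j
    have hp : ∀ g, (p : G → ℝ) g = ∑ i, ∑ j, ξ i * ξ j * (xx i j : G → ℝ) g := fun g => by simp [p]
    have hps : ∀ g, (p : G → ℝ) g = (∑ i, ξ i * (x i : G → ℝ) g) ^ 2 := fun g => by
      rw [hp, sq, Finset.sum_mul_sum]
      exact Finset.sum_congr rfl fun i _ => Finset.sum_congr rfl fun j _ => by rw [hxx]; ring
    have hpT := (hT.integrable_and_integral_le hμ1 hμ (p := p) (by simp [hps, hx.map_one])
      fun g => by rw [hps]; exact sq_nonneg _).2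
    have hpi : ∫ g, (p : G → ℝ) g ∂μ = ∑ i, ∑ j, ξ i * ξ j * ∫ g, (xx i j : G → ℝ) g ∂μ := by
      simp_rw [hp]
      rw [integral_finsetSum _ fun i _ => integrable_finsetSum _ fun j _ => (hxxi i j).const_mul _]
      refine Finset.sum_congr rfl fun i _ => ?_
      rw [integral_finsetSum _ fun j _ => (hxxi i j).const_mul _]
      exact Finset.sum_congr rfl fun j _ => integral_const_mul _ _
    have hTp : T p = ∑ i, ∑ j, ξ i * ξ j * T (xx i j) := by simp [p]
    have e : star ξ ⬝ᵥ a.mulVec ξ = 1 / 2 * (T p - ∫ g, (p : G → ℝ) g ∂μ) := by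
      rw [hpi, hTp, ← Finset.sum_sub_distrib, Finset.mul_sum]
      simp only [dotProduct, Matrix.mulVec, Pi.star_apply, star_trivial, Finset.mul_sum,
        ← Finset.sum_sub_distrib, ha]
      exact Finset.sum_congr rfl fun i _ => Finset.sum_congr rfl fun j _ => by ring
    rw [e]
    linarith
  · let D : Fin d → ℝ := fun i => lieDeriv (Y i) (f : G → ℝ) 1
    let DD : Fin d → Fin d → ℝ := fun i j => lieDeriv (Y i) (lieDeriv (Y j) (f : G → ℝ)) 1
    let Q : SmoothCc E G := ∑ i, ∑ j, DD i j • xx i j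
    -- The cutoff `χ` stands in for the constant `1` to keep `r` compactly supported; near `1`,
    -- where `χ = 1`, `r` is the Taylor remainder.
    let r : SmoothCc E G := f - (f : G → ℝ) 1 • χ - ∑ i, D i • x i - (1 / 2 : ℝ) • Q
    have hQ : ∀ g, (Q : G → ℝ) g = ∑ i, ∑ j, DD i j * (xx i j : G → ℝ) g := fun g => by simp [Q]
    have hr' : ∀ g, (r : G → ℝ) g = (f : G → ℝ) g - (f : G → ℝ) 1 * (χ : G → ℝ) g
        - ∑ i, (x i : G → ℝ) g * D i - 1 / 2 * (Q : G → ℝ) g := fun g => by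
      simp [r, mul_comm (D _)]
    have hQ1 : (Q : G → ℝ) 1 = 0 := by simp [hQ, hxx, hx.map_one]
    obtain ⟨hri, hrT⟩ := hμq r (by rw [hr', hQ1, hχ1']; simp [hx.map_one]) <|
      (Filter.tendsto_congr' (by
        have := hχ1
        rw [nhdsSet_singleton] at this
        filter_upwards [this] with g hg
        rw [hr', hg, mul_one, hQ]
        simp only [hxx, D, DD, mul_comm (lieDeriv _ (lieDeriv _ _) _)])).2
        (hx.tendsto_taylor_remainder_div hxq f)
    have hQi : Integrable (Q : G → ℝ) μ := by
      rw [show (Q : G → ℝ) = fun g => ∑ i, ∑ j, DD i j * (xx i j : G → ℝ) g from funext hQ]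
      exact integrable_finsetSum _ fun i _ => integrable_finsetSum _ fun j _ =>
        (hxxi i j).const_mul _
    have hQint : ∫ g, (Q : G → ℝ) g ∂μ = ∑ i, ∑ j, DD i j * ∫ g, (xx i j : G → ℝ) g ∂μ := by
      simp_rw [hQ]
      rw [integral_finsetSum _ fun i _ => integrable_finsetSum _ fun j _ => (hxxi i j).const_mul _]
      refine Finset.sum_congr rfl fun i _ => ?_
      rw [integral_finsetSum _ fun j _ => (hxxi i j).const_mul _]
      exact Finset.sum_congr rfl fun j _ => integral_const_mul _ _
    -- Splits the compensated integrand into three integrable pieces: `r` matches `T r`, and the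
    -- other two supply the integrals in `a` and `c`.
    have he : (fun g => (f : G → ℝ) g - (f : G → ℝ) 1
        - ∑ i, (x i : G → ℝ) g * lieDeriv (Y i) (f : G → ℝ) 1) =
        fun g => (r : G → ℝ) g + 1 / 2 * (Q : G → ℝ) g - (f : G → ℝ) 1 * (1 - (χ : G → ℝ) g) :=
      funext fun g => by rw [hr']; ring
    have hTr : T r = T f - (f : G → ℝ) 1 * T χ - ∑ i, D i * T (x i)
        - 1 / 2 * ∑ i, ∑ j, DD i j * T (xx i j) := by simp [r, Q]
    have haDD : ∑ i, ∑ j, a i j * DD i j = 1 / 2 * ∑ i, ∑ j, DD i j * T (xx i j)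
        - 1 / 2 * ∑ i, ∑ j, DD i j * ∫ g, (xx i j : G → ℝ) g ∂μ := by
      simp only [Finset.mul_sum, ← Finset.sum_sub_distrib, ha]
      exact Finset.sum_congr rfl fun i _ => Finset.sum_congr rfl fun j _ => by ring
    have hb : ∑ i, T (x i) * lieDeriv (Y i) (f : G → ℝ) 1 = ∑ i, D i * T (x i) :=
      Finset.sum_congr rfl fun i _ => mul_comm _ _
    rw [IntegrableOn, hr, he]
    have hi1 := hri.add (hQi.const_mul (1 / 2))
    refine ⟨hi1.sub (hχi.const_mul _), ?_⟩
    rw [integral_sub (f := fun g => (r : G → ℝ) g + 1 / 2 * (Q : G → ℝ) g) hi1 (hχi.const_mul _),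
      integral_add hri (hQi.const_mul (1 / 2)), integral_const_mul, integral_const_mul, ← hrT,
      hTr, hQint, hb]
    change _ = ∑ i, ∑ j, a i j * DD i j + _ - _ + _
    rw [haDD]
    ring
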